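/- There are absolute constants $k_0 \in \mathbb N$, $C > 0$ and a function $\delta:\mathbb N\to\mathbb R$ with $\delta(n)\to 0$ as $n\to\infty$ such that the following holds. Let $k \ge k_0$ be an integer, $\varepsilon\in(0,1)$ and $\gamma\in(\varepsilon/\log k,\,1/\log k)$ (natural logarithm), and let $G=(V,E)$ be a finite simple graph with $n=|V|$ vertices and $|E|\ge C n\gamma^{-1}$ edges. (Each edge is written as an ordered pair $(u,v)$ in one fixed way.) A linear unique game (an instance of MAX $\Gamma$-Lin over $\mathbb Z/k\mathbb Z$) on $G$ is given by shifts $s_{uv}\in\mathbb Z/k\mathbb Z$ for $(u,v)\in E$, which stand for the constraints $x_v=x_u+s_{uv}$. An adversary chooses a completely satisfiable linear unique game on $G$ and a set $E_\varepsilon\subseteq E$ with $|E_\varepsilon|=\varepsilon|E|$; then the shifts $s_{uv}$, $(u,v)\in E_\varepsilon$, are replaced by independent uniformly random elements of $\mathbb Z/k\mathbb Z$. For the resulting game, consider the shift-invariant SDP relaxation: minimize $$\frac1k\cdot\frac1{2|E|}\sum_{(u,v)\in E}\ \sum_{i\in\mathbb Z/k\mathbb Z}\|u_i-v_{i+s_{uv}}\|^2$$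 over families of vectors $u_i$ ($u\in V$, $i\in\mathbb Z/k\mathbb Z$) in Euclidean spaces of any finite dimension, such that for all $u,v,w\in V$ and $i,j,l,t\in\mathbb Z/k\mathbb Z$: $\|u_i\|=1$; $\langle u_i,u_j\rangle=0$ if $i\ne j$; $\langle u_i,v_j\rangle\ge 0$; $\|u_i-v_j\|^2\le\|u_i-w_l\|^2+\|w_l-v_j\|^2$; and $\|u_i-v_j\|=\|u_{i+t}-v_{j+t}\|$. An edge $(u,v)$ is called $\eta$-short with respect to a solution $\{u_i\}$ if $\frac12\|u_i-v_{i+s_{uv}}\|^2\le\eta$ for every $i\in\mathbb Z/k\mathbb Z$. Then, with probability at least $1-\delta(n)$ over the random shifts, for every optimal SDP solution $\{u_i\}$ at most $\gamma|E|$ edges in $E_\varepsilon$ are $1/32$-short with respect to $\{u_i\}$. -/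

import Mathlib

/-- The first endpoint `u` of an edge `(u, v)`. Every edge of the (undirected) graph is written as an
ordered pair in one fixed but arbitrary way, so that the constraint on it is given by one shift. -/
noncomputable def edgeTail {V : Type*} {G : SimpleGraph V} (e : G.edgeSet) : V :=
  (Quot.out e.1).1

/-- The second endpoint `v` of an edge `(u, v)`. -/
noncomputable def edgeHead {V : Type*} {G : SimpleGraph V} (e : G.edgeSet) : V :=
  (Quot.out e.1).2

/-- An instance of Linear Unique Games (MAX Γ-Lin) over `ℤ/kℤ` on the constraint graph `G`:
a shift `s e` for every edge `e = (u, v)`, which stands for the constraint `x_v = x_u + s e`. -/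
abbrev LinearGame {V : Type*} (G : SimpleGraph V) (k : ℕ) : Type _ :=
  G.edgeSet → ZMod k

/-- Some labelling of the vertices satisfies all constraints of the game. -/
def LinearGame.IsSatisfiable {V : Type*} {G : SimpleGraph V} {k : ℕ} (s : LinearGame G k) : Prop :=
  ∃ x : V → ZMod k, ∀ e : G.edgeSet, x (edgeHead e) = x (edgeTail e) + s e

open Classical in
/-- The game `s` with the constraints on the edges in `Eε` replaced by the shifts `r`. -/
noncomputable def LinearGame.corrupt {V : Type*} {G : SimpleGraph V} {k : ℕ} (s : LinearGame G k)
    (Eε : Finset G.edgeSet) (r : Eε → ZMod k) : LinearGame G k :=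
  fun e => if h : e ∈ Eε then r ⟨e, h⟩ else s e

open Classical in
/-- The random game in which the constraints on the edges in `Eε` have been replaced by
independent, uniformly distributed random shifts. -/
noncomputable def LinearGame.randomlyCorrupted {V : Type*} {G : SimpleGraph V} {k : ℕ} [NeZero k]
    (s : LinearGame G k) (Eε : Finset G.edgeSet) : PMF (LinearGame G k) :=
  (PMF.uniformOfFintype (Eε → ZMod k)).map (s.corrupt Eε)

/-- The constraints of the shift-invariant SDP relaxation, for a vector `u v i` for every vertex `v`
and every label `i`. -/
structure IsSDPFeasible {V : Type*} {k : ℕ} {F : Type*} [NormedAddCommGroup F]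
    [InnerProductSpace ℝ F] (u : V → ZMod k → F) : Prop where
  norm_eq_one : ∀ v i, ‖u v i‖ = 1
  orthogonal : ∀ v i j, i ≠ j → inner ℝ (u v i) (u v j) = 0
  inner_nonneg : ∀ v w i j, 0 ≤ inner ℝ (u v i) (u w j)
  triangle : ∀ v w z i j l,
    ‖u v i - u w j‖ ^ 2 ≤ ‖u v i - u z l‖ ^ 2 + ‖u z l - u w j‖ ^ 2
  shift_invariant : ∀ v w i j t, ‖u v i - u w j‖ = ‖u v (i + t) - u w (j + t)‖

/-- The objective function of the shift-invariant SDP relaxation. -/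
noncomputable def LinearGame.sdpValue {V : Type*} {G : SimpleGraph V} [Fintype G.edgeSet] {k : ℕ}
    [NeZero k] (s : LinearGame G k) {F : Type*} [NormedAddCommGroup F] [InnerProductSpace ℝ F]
    (u : V → ZMod k → F) : ℝ :=
  1 / (k : ℝ) * (1 / (2 * (Fintype.card G.edgeSet : ℝ))) *
    ∑ e : G.edgeSet, ∑ i : ZMod k, ‖u (edgeTail e) i - u (edgeHead e) (i + s e)‖ ^ 2

/-- `u` is an optimal solution of the shift-invariant SDP relaxation of the game `s`; the vectors
may lie in a Euclidean space of any finite dimension. -/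
def LinearGame.IsSDPOptimal {V : Type*} {G : SimpleGraph V} [Fintype G.edgeSet] {k : ℕ}
    [NeZero k] (s : LinearGame G k) {d : ℕ} (u : V → ZMod k → EuclideanSpace ℝ (Fin d)) : Prop :=
  IsSDPFeasible u ∧
    ∀ (d' : ℕ) (u' : V → ZMod k → EuclideanSpace ℝ (Fin d')),
      IsSDPFeasible u' → s.sdpValue u ≤ s.sdpValue u'

/-- The edge `e` of the game `s` is `η`-short with respect to the SDP solution `u`. -/
def LinearGame.IsShort {V : Type*} {G : SimpleGraph V} {k : ℕ} (s : LinearGame G k)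
    {F : Type*} [NormedAddCommGroup F] [InnerProductSpace ℝ F] (u : V → ZMod k → F) (η : ℝ)
    (e : G.edgeSet) : Prop :=
  ∀ i : ZMod k, 1 / 2 * ‖u (edgeTail e) i - u (edgeHead e) (i + s e)‖ ^ 2 ≤ η

/-!
The sketch of an orthonormal family `(u_i)` is its discrete Fourier transform at a random frequency,
projected in a random `±1` direction. Translating a family multiplies its sketch by a known
character value, so by Parseval the mean squared distance between the sketch of `u` and the twisted
sketch of `v` is the average over `i` of `‖u_i - v_{i+t}‖²`: at most `1/16` when `t` is the shift of
a short edge `(u, v)`, at least `15/16` for every other `t`. This gap survives rounding the sketches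
to an absolute finite set, where fourth moments control the error, so `O(log k)` rounded samples per
vertex determine the shift of a short edge with probability at least `1/2`.

Hence, whatever the dimension of the vectors, one of only `exp(O(n log k))` functions of a pair of
vertices predicts the shifts on half of the short edges. A fixed function agrees with the random
shifts on `γ|E|/2` edges of `E_ε` with probability at most `exp(-Ω(γ|E| log k))`, and
`|E| ≥ C n / γ` makes a union bound over these functions succeed.
-/

open MeasureTheory ProbabilityTheory
open scoped BigOperators ZMod

section Sampling

lemma integral_uniformOfFintype {Ω : Type*} [Fintype Ω] [Nonempty Ω] [MeasurableSpace Ω]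
    [MeasurableSingletonClass Ω] (f : Ω → ℝ) :
    ∫ x, f x ∂(PMF.uniformOfFintype Ω).toMeasure = 𝔼 x, f x := by
  simp [PMF.integral_eq_sum, Fintype.expect_eq_sum_div_card, div_eq_inv_mul, Finset.mul_sum]

variable {Ω : Type*} [MeasurableSpace Ω] {μ : Measure Ω} [IsProbabilityMeasure μ]

lemma measureReal_pi_sum_ge_le {Z : Ω → ℝ} {a b : ℝ} (hZ : AEMeasurable Z μ)
    (hab : ∀ᵐ x ∂μ, Z x ∈ Set.Icc a b) {τ : ℝ} (hτ : 0 ≤ τ) (L : ℕ) :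
    (Measure.pi fun _ : Fin L => μ).real {ω | L * (∫ x, Z x ∂μ + τ) ≤ ∑ l, Z (ω l)} ≤
      Real.exp (-(2 * L * τ ^ 2 / (b - a) ^ 2)) := by
  have hindep : iIndepFun (fun l (ω : Fin L → Ω) => Z (ω l) - ∫ x, Z x ∂μ)
      (Measure.pi fun _ => μ) :=
    iIndepFun_pi fun _ => hZ.sub_const _
  have hsub (l : Fin L) : HasSubgaussianMGF (fun ω : Fin L → Ω => Z (ω l) - ∫ x, Z x ∂μ)
      ((‖b - a‖₊ / 2) ^ 2) (Measure.pi fun _ => μ) := by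
    have hl := measurePreserving_eval (fun _ : Fin L => μ) l
    exact HasSubgaussianMGF.of_map (X := fun x => Z x - ∫ y, Z y ∂μ) hl.aemeasurable
      (hl.map_eq.symm ▸ hasSubgaussianMGF_of_mem_Icc hZ hab)
  have hoeffding := HasSubgaussianMGF.measure_sum_ge_le_of_iIndepFun hindep
    (s := Finset.univ) (fun l _ => hsub l) (ε := L * τ) (by positivity)
  convert hoeffding using 2
  · simp [Finset.sum_sub_distrib, mul_add, le_sub_iff_add_le, add_comm]
  · rcases eq_or_ne L 0 with rfl | hL
    · simp
    rcases eq_or_ne a b with rfl | hab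
    · simp
    have := sub_ne_zero.2 hab.symm
    simp only [Finset.sum_const, Finset.card_univ, Fintype.card_fin, nsmul_eq_mul,
      NNReal.coe_mul, NNReal.coe_natCast, NNReal.coe_pow, NNReal.coe_div, NNReal.coe_ofNat,
      coe_nnnorm, Real.norm_eq_abs, div_pow, sq_abs]
    field_simp

lemma measureReal_pi_sum_le_le {Z : Ω → ℝ} {a b : ℝ} (hZ : AEMeasurable Z μ)
    (hab : ∀ᵐ x ∂μ, Z x ∈ Set.Icc a b) {τ : ℝ} (hτ : 0 ≤ τ) (L : ℕ) :
    (Measure.pi fun _ : Fin L => μ).real {ω | ∑ l, Z (ω l) ≤ L * (∫ x, Z x ∂μ - τ)} ≤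
      Real.exp (-(2 * L * τ ^ 2 / (b - a) ^ 2)) := by
  have hneg : ∀ᵐ x ∂μ, -Z x ∈ Set.Icc (-b) (-a) := by
    filter_upwards [hab] with x hx using ⟨neg_le_neg hx.2, neg_le_neg hx.1⟩
  convert measureReal_pi_sum_ge_le hZ.neg hneg hτ L using 3
  · ext ω
    simp only [Pi.neg_apply, integral_neg, Finset.sum_neg_distrib]
    rw [← neg_le_neg_iff, ← mul_neg, neg_sub, sub_eq_add_neg, add_comm τ]
  · ring

lemma one_sub_le_measureReal_pi_forall_sum_lt_iff {S : Type*} [Fintype S] {Z : S → Ω → ℝ}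
    {a b : ℝ} (hZ : ∀ t, AEMeasurable (Z t) μ) (hab : ∀ t, ∀ᵐ x ∂μ, Z t x ∈ Set.Icc a b)
    {s : S} {θ τ : ℝ} (hτ : 0 ≤ τ) (hs : ∫ x, Z s x ∂μ ≤ θ - τ)
    (ht : ∀ t, t ≠ s → θ + τ ≤ ∫ x, Z t x ∂μ) (L : ℕ) :
    1 - Fintype.card S * Real.exp (-(2 * L * τ ^ 2 / (b - a) ^ 2)) ≤
      (Measure.pi fun _ : Fin L => μ).real {ω | ∀ t, ∑ l, Z t (ω l) < L * θ ↔ t = s} := by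
  set P := Measure.pi fun _ : Fin L => μ
  set wrong : S → Set (Fin L → Ω) := fun t => {ω | ¬(∑ l, Z t (ω l) < L * θ ↔ t = s)}
  have hwrong (t : S) : P.real (wrong t) ≤ Real.exp (-(2 * L * τ ^ 2 / (b - a) ^ 2)) := by
    rcases eq_or_ne t s with rfl | hts
    · refine (measureReal_mono fun ω hω => ?_).trans (measureReal_pi_sum_ge_le (hZ t) (hab t) hτ L)
      simp only [wrong, Set.mem_ofPred_eq, iff_true, not_lt] at hω ⊢
      exact le_trans (by gcongr; linarith) hω
    · refine (measureReal_mono fun ω hω => ?_).trans (measureReal_pi_sum_le_le (hZ t) (hab t) hτ L)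
      simp only [wrong, Set.mem_ofPred_eq, hts, iff_false, not_not] at hω ⊢
      exact hω.le.trans (by gcongr; linarith [ht t hts])
  have hcompl : {ω | ∀ t, ∑ l, Z t (ω l) < L * θ ↔ t = s}ᶜ = ⋃ t, wrong t := by
    ext ω
    simp [wrong]
  have hunion : P.real (⋃ t, wrong t) ≤
      Fintype.card S * Real.exp (-(2 * L * τ ^ 2 / (b - a) ^ 2)) := by
    refine (measureReal_iUnion_fintype_le _).trans ?_
    simpa using Finset.sum_le_card_nsmul Finset.univ _ _ fun t _ => hwrong t
  have htotal := measureReal_union_le (μ := P) {ω | ∀ t, ∑ l, Z t (ω l) < L * θ ↔ t = s}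
    {ω | ∀ t, ∑ l, Z t (ω l) < L * θ ↔ t = s}ᶜ
  rw [Set.union_compl_self, probReal_univ, hcompl] at htotal
  linarith

lemma exists_mul_card_le_card_filter {ι : Type*} (F : Finset ι) {p : Ω → ι → Prop}
    [∀ x, DecidablePred (p x)] (hp : ∀ e ∈ F, MeasurableSet {x | p x e}) {c : ℝ}
    (hc : ∀ e ∈ F, c ≤ μ.real {x | p x e}) :
    ∃ x, c * F.card ≤ (F.filter (p x)).card := by
  have hint (e) (he : e ∈ F) : Integrable ({x | p x e}.indicator (1 : Ω → ℝ)) μ :=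
    (integrable_const 1).indicator (hp e he)
  obtain ⟨x, hx⟩ := exists_integral_le (integrable_finsetSum F hint)
  refine ⟨x, ?_⟩
  calc c * F.card ≤ ∑ e ∈ F, μ.real {x | p x e} := by
        simpa [mul_comm] using Finset.card_nsmul_le_sum F _ c hc
    _ = ∫ x, ∑ e ∈ F, {x | p x e}.indicator (1 : Ω → ℝ) x ∂μ := by
        rw [integral_finsetSum F hint]
        exact Finset.sum_congr rfl fun e he => (integral_indicator_one (hp e he)).symm
    _ ≤ ∑ e ∈ F, {x | p x e}.indicator (1 : Ω → ℝ) x := hx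
    _ = (F.filter (p x)).card := by simp [Set.indicator_apply]

end Sampling

section RandomSigns

lemma expect_fin_succ {α : Type*} [Fintype α] {d : ℕ} (f : (Fin (d + 1) → α) → ℝ) :
    𝔼 r, f r = 𝔼 r : Fin d → α, 𝔼 x, f (Fin.cons x r) := by
  rw [← Fintype.expect_equiv (Fin.consEquiv fun _ => α) _ f fun _ => rfl,
    ← Finset.univ_product_univ, Finset.expect_product, Finset.expect_comm]
  rfl

lemma expect_intUnits (f : ℤˣ → ℝ) : 𝔼 x, f x = (f 1 + f (-1)) / 2 := by
  rw [UnitsInt.univ, Finset.expect_eq_sum_div_card]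
  simp

variable {E : Type*} [NormedAddCommGroup E] [InnerProductSpace ℝ E]

lemma expect_norm_sum_signs_smul_sq {d : ℕ} (a : Fin d → E) :
    𝔼 r : Fin d → ℤˣ, ‖∑ j, r j • a j‖ ^ 2 = ∑ j, ‖a j‖ ^ 2 := by
  induction d with
  | zero => simp
  | succ d ih =>
    have parallelogram (S : E) :
        (‖a 0 + S‖ ^ 2 + ‖-a 0 + S‖ ^ 2) / 2 = ‖a 0‖ ^ 2 + ‖S‖ ^ 2 := by
      rw [norm_add_sq_real, norm_add_sq_real, norm_neg, inner_neg_left]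
      ring
    simp only [expect_fin_succ, expect_intUnits, Fin.sum_univ_succ, Fin.cons_zero, Fin.cons_succ,
      one_smul, Units.neg_smul, parallelogram]
    rw [Finset.expect_add_distrib, Fintype.expect_const, ih]

lemma norm_add_pow_four_add_norm_sub_pow_four_le (a b : E) :
    (‖a + b‖ ^ 4 + ‖-a + b‖ ^ 4) / 2 ≤ ‖a‖ ^ 4 + 6 * ‖a‖ ^ 2 * ‖b‖ ^ 2 + ‖b‖ ^ 4 := by
  have hadd := norm_add_sq_real a b
  have hsub := norm_add_sq_real (-a) b
  rw [norm_neg, inner_neg_left] at hsub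
  have hinner : inner ℝ a b ^ 2 ≤ (‖a‖ * ‖b‖) ^ 2 := sq_le_sq.2 <| by
    simpa [abs_mul] using abs_real_inner_le_norm a b
  calc (‖a + b‖ ^ 4 + ‖-a + b‖ ^ 4) / 2
      = ((‖a + b‖ ^ 2) ^ 2 + (‖-a + b‖ ^ 2) ^ 2) / 2 := by ring
    _ = (‖a‖ ^ 2 + ‖b‖ ^ 2) ^ 2 + 4 * inner ℝ a b ^ 2 := by rw [hadd, hsub]; ring
    _ ≤ (‖a‖ ^ 2 + ‖b‖ ^ 2) ^ 2 + 4 * (‖a‖ * ‖b‖) ^ 2 := by gcongr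
    _ = ‖a‖ ^ 4 + 6 * ‖a‖ ^ 2 * ‖b‖ ^ 2 + ‖b‖ ^ 4 := by ring

/-- The case of exponent `4` of Khintchine's inequality. -/
lemma expect_norm_sum_signs_smul_pow_four_le {d : ℕ} (a : Fin d → E) :
    𝔼 r : Fin d → ℤˣ, ‖∑ j, r j • a j‖ ^ 4 ≤ 3 * (∑ j, ‖a j‖ ^ 2) ^ 2 := by
  induction d with
  | zero => simp
  | succ d ih =>
    simp only [expect_fin_succ, expect_intUnits, Fin.sum_univ_succ, Fin.cons_zero, Fin.cons_succ,
      one_smul, Units.neg_smul]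
    calc _ ≤ 𝔼 r : Fin d → ℤˣ, (‖a 0‖ ^ 4 + 6 * ‖a 0‖ ^ 2 * ‖∑ j, r j • a j.succ‖ ^ 2 +
            ‖∑ j, r j • a j.succ‖ ^ 4) :=
          Finset.expect_le_expect fun r _ => norm_add_pow_four_add_norm_sub_pow_four_le _ _
      _ = ‖a 0‖ ^ 4 + 6 * ‖a 0‖ ^ 2 * ∑ j : Fin d, ‖a j.succ‖ ^ 2 +
            𝔼 r : Fin d → ℤˣ, ‖∑ j, r j • a j.succ‖ ^ 4 := by
          rw [Finset.expect_add_distrib, Finset.expect_add_distrib, Fintype.expect_const,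
            ← Finset.mul_expect, expect_norm_sum_signs_smul_sq fun j => a j.succ]
      _ ≤ ‖a 0‖ ^ 4 + 6 * ‖a 0‖ ^ 2 * ∑ j : Fin d, ‖a j.succ‖ ^ 2 +
            3 * (∑ j : Fin d, ‖a j.succ‖ ^ 2) ^ 2 := by gcongr; exact ih _
      _ ≤ 3 * (‖a 0‖ ^ 2 + ∑ j : Fin d, ‖a j.succ‖ ^ 2) ^ 2 := by
          have : 0 ≤ ‖a 0‖ ^ 4 := by positivity
          linarith

end RandomSigns

section DiscreteFourierTransform

variable {k : ℕ} [NeZero k]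

lemma dft_comp_add_right {E : Type*} [AddCommGroup E] [Module ℂ E] (w : ZMod k → E)
    (t χ : ZMod k) :
    𝓕 (fun i => w (i + t)) χ = ZMod.stdAddChar (t * χ) • 𝓕 w χ := by
  rw [ZMod.dft_apply, ZMod.dft_apply, Finset.smul_sum]
  refine Fintype.sum_equiv (Equiv.addRight t) _ _ fun i => ?_
  rw [Equiv.coe_addRight, smul_smul, ← AddChar.map_add_eq_mul]
  congr 2
  ring

variable {E : Type*} [NormedAddCommGroup E] [InnerProductSpace ℂ E]

lemma sum_norm_dft_sq (w : ZMod k → E) : ∑ χ, ‖𝓕 w χ‖ ^ 2 = k * ∑ i, ‖w i‖ ^ 2 := by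
  have hinversion (i : ZMod k) : ∑ χ, ZMod.stdAddChar (i * χ) • 𝓕 w χ = (k : ℂ) • w i := by
    have := congrFun (ZMod.dft_dft w) (-i)
    rw [ZMod.dft_apply, neg_neg] at this
    simpa [mul_comm] using this
  have hinner : ∑ χ, inner ℂ (𝓕 w χ) (𝓕 w χ) = k * ∑ i, inner ℂ (w i) (w i) := by
    calc ∑ χ, inner ℂ (𝓕 w χ) (𝓕 w χ)
        = ∑ χ, ∑ i, inner ℂ (w i) (ZMod.stdAddChar (i * χ) • 𝓕 w χ) := by
          refine Finset.sum_congr rfl fun χ _ => ?_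
          nth_rw 1 [ZMod.dft_apply]
          simp only [sum_inner, inner_smul_left, inner_smul_right, AddChar.map_neg_eq_conj,
            RCLike.conj_conj]
      _ = ∑ i, inner ℂ (w i) ((k : ℂ) • w i) := by
          rw [Finset.sum_comm]
          simp only [← inner_sum, hinversion]
      _ = k * ∑ i, inner ℂ (w i) (w i) := by simp only [inner_smul_right, Finset.mul_sum]
  simp only [inner_self_eq_norm_sq_to_K, Complex.coe_algebraMap] at hinner
  exact_mod_cast hinner

lemma norm_dft_sq_of_orthonormal {w : ZMod k → E} (hw : Orthonormal ℂ w) (χ : ZMod k) :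
    ‖𝓕 w χ‖ ^ 2 = k := by
  have hinner : inner ℂ (𝓕 w χ) (𝓕 w χ) = k := by
    rw [ZMod.dft_apply, hw.inner_sum]
    simp only [← AddChar.map_neg_eq_conj, ← AddChar.map_add_eq_mul, neg_add_cancel,
      AddChar.map_zero_eq_one, Finset.sum_const, Finset.card_univ, ZMod.card, nsmul_eq_mul, mul_one]
  rw [inner_self_eq_norm_sq_to_K] at hinner
  simp only [Complex.coe_algebraMap] at hinner
  exact_mod_cast hinner

end DiscreteFourierTransform

section Complexification

variable {ι : Type*} [Fintype ι]

/-- The image of `x` under the coordinatewise inclusion of real into complex Euclidean space. -/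
noncomputable def complexify (x : EuclideanSpace ℝ ι) : EuclideanSpace ℂ ι :=
  WithLp.toLp 2 fun j => (x j : ℂ)

lemma inner_complexify (x y : EuclideanSpace ℝ ι) :
    inner ℂ (complexify x) (complexify y) = (inner ℝ x y : ℂ) := by
  simp [complexify, PiLp.inner_apply]

lemma norm_complexify_sub (x y : EuclideanSpace ℝ ι) :
    ‖complexify x - complexify y‖ = ‖x - y‖ := by
  simp [complexify, EuclideanSpace.norm_eq, ← Complex.ofReal_sub]

lemma orthonormal_complexify {κ : Type*} {w : κ → EuclideanSpace ℝ ι} (hw : Orthonormal ℝ w) :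
    Orthonormal ℂ fun i => complexify (w i) := by
  classical
  rw [orthonormal_iff_ite] at hw ⊢
  intro i j
  rw [inner_complexify, hw]
  split_ifs <;> simp

end Complexification

section Quantization

lemma exists_finite_quantizer {E : Type*} [NormedAddCommGroup E] [ProperSpace E] {a : ℝ}
    (ha : 0 < a) :
    ∃ (Q : Finset E) (q : E → Q), ∀ x, ‖x - q x‖ ^ 2 ≤ a * (1 + ‖x‖ ^ 4) := by
  classical
  obtain ⟨t, ht, hcover⟩ := Metric.totallyBounded_iff.1
    (isCompact_closedBall (0 : E) (√a⁻¹)).totallyBounded (√a) (Real.sqrt_pos.2 ha)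
  suffices ∀ x : E, ∃ y : (insert 0 ht.toFinset : Finset E),
      ‖x - (y : E)‖ ^ 2 ≤ a * (1 + ‖x‖ ^ 4) by
    choose q hq using this
    exact ⟨insert 0 ht.toFinset, q, hq⟩
  intro x
  rcases le_or_gt ‖x‖ (√a⁻¹) with hx | hx
  · obtain ⟨y, hy, hxy⟩ := Set.mem_iUnion₂.1 (hcover (mem_closedBall_zero_iff.2 hx))
    rw [Metric.mem_ball, dist_eq_norm] at hxy
    refine ⟨⟨y, by simp [hy]⟩, ?_⟩
    calc ‖x - y‖ ^ 2 ≤ √a ^ 2 := by gcongr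
      _ = a := Real.sq_sqrt ha.le
      _ ≤ a * (1 + ‖x‖ ^ 4) := le_mul_of_one_le_right ha.le (by simp)
  · have hx1 : 1 ≤ a * ‖x‖ ^ 2 := by
      rw [← inv_mul_le_iff₀ ha, mul_one]
      exact ((Real.sqrt_lt (by positivity) (norm_nonneg x)).1 hx).le
    refine ⟨⟨0, by simp⟩, ?_⟩
    calc ‖x - 0‖ ^ 2 ≤ ‖x‖ ^ 2 * (a * ‖x‖ ^ 2) := by
          rw [sub_zero]
          exact le_mul_of_one_le_right (by positivity) hx1
      _ ≤ a * (1 + ‖x‖ ^ 4) := by linarith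

lemma norm_sub_sq_le_two {E : Type*} [SeminormedAddCommGroup E] (x y z : E) :
    ‖x - z‖ ^ 2 ≤ 2 * ‖x - y‖ ^ 2 + 2 * ‖y - z‖ ^ 2 := by
  calc ‖x - z‖ ^ 2 ≤ (‖x - y‖ + ‖y - z‖) ^ 2 := by
        gcongr
        exact norm_sub_le_norm_sub_add_norm_sub x y z
    _ ≤ 2 * (‖x - y‖ ^ 2 + ‖y - z‖ ^ 2) := add_sq_le
    _ = 2 * ‖x - y‖ ^ 2 + 2 * ‖y - z‖ ^ 2 := mul_add _ _ _

lemma norm_sub_mul_sq_le_of_norm_eq_one {c : ℂ} (hc : ‖c‖ = 1) (y y' z z' : ℂ) :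
    ‖y' - c * z'‖ ^ 2 ≤ 2 * ‖y - c * z‖ ^ 2 + 4 * ‖y - y'‖ ^ 2 + 4 * ‖z - z'‖ ^ 2 := by
  have htriangle := norm_sub_sq_le_two (y' - c * z') (y - c * z) 0
  have herror := norm_sub_sq_le_two (y' - y) 0 (c * (z' - z))
  rw [sub_zero, sub_zero] at htriangle
  rw [sub_zero, zero_sub, norm_neg, norm_mul, hc, one_mul, norm_sub_rev y', norm_sub_rev z',
    show y' - y - c * (z' - z) = y' - c * z' - (y - c * z) by ring] at herror
  linarith

end Quantization

section Sketch

variable {k : ℕ} [NeZero k] {d : ℕ}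

/-- A random number that summarises the family `w`: the random signs `p.2` combine the coordinates
of the Fourier coefficient of `w` at the random frequency `p.1`. -/
noncomputable def sketch (w : ZMod k → EuclideanSpace ℂ (Fin d)) (p : ZMod k × (Fin d → ℤˣ)) : ℂ :=
  (√(k : ℝ))⁻¹ * ∑ j, p.2 j • 𝓕 w p.1 j

lemma sketch_sub_comp_add_right (u v : ZMod k → EuclideanSpace ℂ (Fin d)) (t : ZMod k)
    (p : ZMod k × (Fin d → ℤˣ)) :
    sketch (fun i => u i - v (i + t)) p =
      sketch u p - ZMod.stdAddChar (t * p.1) * sketch v p := by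
  have hdft : 𝓕 (fun i => u i - v (i + t)) p.1 =
      𝓕 u p.1 - ZMod.stdAddChar (t * p.1) • 𝓕 v p.1 := by
    rw [← dft_comp_add_right]
    exact congrFun (map_sub ZMod.dft u fun i => v (i + t)) p.1
  simp only [sketch, hdft, PiLp.sub_apply, PiLp.smul_apply, smul_sub, Finset.sum_sub_distrib,
    mul_sub, smul_eq_mul, mul_left_comm (ZMod.stdAddChar _), Finset.mul_sum, mul_smul_comm]

lemma norm_sketch_sq (w : ZMod k → EuclideanSpace ℂ (Fin d)) (p : ZMod k × (Fin d → ℤˣ)) :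
    ‖sketch w p‖ ^ 2 = (k : ℝ)⁻¹ * ‖∑ j, p.2 j • 𝓕 w p.1 j‖ ^ 2 := by
  rw [sketch, norm_mul, mul_pow, Complex.norm_real, Real.norm_eq_abs, sq_abs,
    inv_pow, Real.sq_sqrt k.cast_nonneg]

lemma expect_norm_sketch_sq (w : ZMod k → EuclideanSpace ℂ (Fin d)) :
    𝔼 p, ‖sketch w p‖ ^ 2 = 𝔼 i, ‖w i‖ ^ 2 := by
  have hk : (k : ℝ) ≠ 0 := Nat.cast_ne_zero.2 (NeZero.ne k)
  simp only [norm_sketch_sq]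
  rw [← Finset.univ_product_univ, Finset.expect_product]
  simp only [← Finset.mul_expect, expect_norm_sum_signs_smul_sq, ← EuclideanSpace.norm_sq_eq]
  rw [Fintype.expect_eq_sum_div_card, sum_norm_dft_sq, Fintype.expect_eq_sum_div_card, ZMod.card]
  field_simp

lemma expect_norm_sketch_pow_four_le {w : ZMod k → EuclideanSpace ℂ (Fin d)}
    (hw : Orthonormal ℂ w) : 𝔼 p, ‖sketch w p‖ ^ 4 ≤ 3 := by
  have hk : (k : ℝ) ≠ 0 := Nat.cast_ne_zero.2 (NeZero.ne k)
  have hpow (p : ZMod k × (Fin d → ℤˣ)) :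
      ‖sketch w p‖ ^ 4 = ((k : ℝ)⁻¹) ^ 2 * ‖∑ j, p.2 j • 𝓕 w p.1 j‖ ^ 4 := by
    rw [show 4 = 2 * 2 from rfl, pow_mul, norm_sketch_sq, mul_pow, ← pow_mul]
  simp only [hpow]
  rw [← Finset.univ_product_univ, Finset.expect_product]
  refine Finset.expect_le Finset.univ_nonempty fun χ _ => ?_
  calc 𝔼 r : Fin d → ℤˣ, ((k : ℝ)⁻¹) ^ 2 * ‖∑ j, r j • 𝓕 w χ j‖ ^ 4
      ≤ ((k : ℝ)⁻¹) ^ 2 * (3 * (∑ j, ‖𝓕 w χ j‖ ^ 2) ^ 2) := by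
        rw [← Finset.mul_expect]
        gcongr
        exact expect_norm_sum_signs_smul_pow_four_le _
    _ = 3 := by
        rw [← EuclideanSpace.norm_sq_eq, norm_dft_sq_of_orthonormal hw]
        field_simp

variable {a : ℝ} {q : ℂ → ℂ} {u v : ZMod k → EuclideanSpace ℂ (Fin d)}

lemma expect_norm_sketch_sub_sq_le {w : ZMod k → EuclideanSpace ℂ (Fin d)} (hw : Orthonormal ℂ w)
    (ha : 0 ≤ a) (hq : ∀ x, ‖x - q x‖ ^ 2 ≤ a * (1 + ‖x‖ ^ 4)) :
    𝔼 p, ‖sketch w p - q (sketch w p)‖ ^ 2 ≤ 4 * a := by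
  calc 𝔼 p, ‖sketch w p - q (sketch w p)‖ ^ 2
      ≤ 𝔼 p, a * (1 + ‖sketch w p‖ ^ 4) := Finset.expect_le_expect fun p _ => hq _
    _ = a * (1 + 𝔼 p, ‖sketch w p‖ ^ 4) := by
        rw [← Finset.mul_expect, Finset.expect_add_distrib, Fintype.expect_const]
    _ ≤ a * (1 + 3) := by
        gcongr
        exact expect_norm_sketch_pow_four_le hw
    _ = 4 * a := by ring

/-- How far the sketches `y` and `z` at the frequency `χ` are from those of a family and its
translate by `t`. -/
noncomputable def mismatch (χ t : ZMod k) (y z : ℂ) : ℝ :=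
  ‖y - ZMod.stdAddChar (t * χ) * z‖ ^ 2

lemma mismatch_mem_Icc {B : ℝ} {y z : ℂ} (hy : 4 * ‖y‖ ^ 2 ≤ B) (hz : 4 * ‖z‖ ^ 2 ≤ B)
    (χ t : ZMod k) : mismatch χ t y z ∈ Set.Icc 0 B := by
  have h := norm_sub_sq_le_two y 0 (ZMod.stdAddChar (t * χ) * z)
  rw [sub_zero, zero_sub, norm_neg, norm_mul, AddChar.norm_apply, one_mul] at h
  exact ⟨sq_nonneg _, h.trans (by linarith)⟩

lemma expect_mismatch_sketch (u v : ZMod k → EuclideanSpace ℂ (Fin d)) (t : ZMod k) :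
    𝔼 p, mismatch p.1 t (sketch u p) (sketch v p) = 𝔼 i, ‖u i - v (i + t)‖ ^ 2 := by
  simp only [mismatch, ← sketch_sub_comp_add_right]
  exact expect_norm_sketch_sq _

lemma expect_mismatch_quantized_le (hu : Orthonormal ℂ u) (hv : Orthonormal ℂ v)
    (ha : 0 ≤ a) (hq : ∀ x, ‖x - q x‖ ^ 2 ≤ a * (1 + ‖x‖ ^ 4)) (t : ZMod k) :
    𝔼 p, mismatch p.1 t (q (sketch u p)) (q (sketch v p)) ≤
      2 * 𝔼 i, ‖u i - v (i + t)‖ ^ 2 + 32 * a := by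
  have hpointwise := Finset.expect_le_expect (s := Finset.univ) fun p _ =>
    norm_sub_mul_sq_le_of_norm_eq_one (AddChar.norm_apply ZMod.stdAddChar (t * p.1))
      (sketch u p) (q (sketch u p)) (sketch v p) (q (sketch v p))
  rw [Finset.expect_add_distrib, Finset.expect_add_distrib, ← Finset.mul_expect,
    ← Finset.mul_expect, ← Finset.mul_expect] at hpointwise
  have hmean := expect_mismatch_sketch u v t
  have hu' := expect_norm_sketch_sub_sq_le hu ha hq
  have hv' := expect_norm_sketch_sub_sq_le hv ha hq
  simp only [mismatch] at hmean ⊢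
  linarith

lemma expect_norm_sub_sq_le_mismatch_quantized (hu : Orthonormal ℂ u) (hv : Orthonormal ℂ v)
    (ha : 0 ≤ a) (hq : ∀ x, ‖x - q x‖ ^ 2 ≤ a * (1 + ‖x‖ ^ 4)) (t : ZMod k) :
    𝔼 i, ‖u i - v (i + t)‖ ^ 2 ≤
      2 * 𝔼 p, mismatch p.1 t (q (sketch u p)) (q (sketch v p)) + 32 * a := by
  have hpointwise := Finset.expect_le_expect (s := Finset.univ) fun p _ =>
    norm_sub_mul_sq_le_of_norm_eq_one (AddChar.norm_apply ZMod.stdAddChar (t * p.1))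
      (q (sketch u p)) (sketch u p) (q (sketch v p)) (sketch v p)
  rw [Finset.expect_add_distrib, Finset.expect_add_distrib, ← Finset.mul_expect,
    ← Finset.mul_expect, ← Finset.mul_expect] at hpointwise
  simp only [norm_sub_rev (q (sketch u _)) (sketch u _),
    norm_sub_rev (q (sketch v _)) (sketch v _)] at hpointwise
  have hmean := expect_mismatch_sketch u v t
  have hu' := expect_norm_sketch_sub_sq_le hu ha hq
  have hv' := expect_norm_sketch_sub_sq_le hv ha hq
  simp only [mismatch] at hmean ⊢
  linarith

end Sketch

section Decoding

instance measurableSingletonClass_units {M : Type*} [Monoid M] [MeasurableSpace M]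
    [MeasurableSingletonClass M] : MeasurableSingletonClass Mˣ where
  measurableSet_singleton x := ⟨{(x : M)}, measurableSet_singleton _, by ext; simp [Units.ext_iff]⟩

variable {k : ℕ} [NeZero k] {d : ℕ}

/-- The shift for which the total mismatch of the `L` given pairs of sketches is below `5 / 16` per
pair, the midpoint of the two bounds on the expected mismatch; arbitrary if this shift is not
unique. -/
noncomputable def decodeShift {L : ℕ} (χ : Fin L → ZMod k) (y z : Fin L → ℂ) : ZMod k :=
  Classical.epsilon fun t => ∑ l, mismatch (χ l) t (y l) (z l) < L * (5 / 16)

lemma decodeShift_eq {L : ℕ} {χ : Fin L → ZMod k} {y z : Fin L → ℂ} {s : ZMod k}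
    (h : ∀ t, ∑ l, mismatch (χ l) t (y l) (z l) < L * (5 / 16) ↔ t = s) :
    decodeShift χ y z = s := by
  simp only [decodeShift, h]
  exact Classical.epsilon_singleton s

lemma expect_mismatch_quantized_separated {q : ℂ → ℂ}
    (hq : ∀ x, ‖x - q x‖ ^ 2 ≤ 1 / 256 * (1 + ‖x‖ ^ 4))
    {u v : ZMod k → EuclideanSpace ℂ (Fin d)} (hu : Orthonormal ℂ u) (hv : Orthonormal ℂ v)
    {s : ZMod k} (hs : ∀ i, ‖u i - v (i + s)‖ ^ 2 ≤ 1 / 16) :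
    𝔼 p, mismatch p.1 s (q (sketch u p)) (q (sketch v p)) ≤ 5 / 16 - 1 / 16 ∧
      ∀ t, t ≠ s → 5 / 16 + 1 / 16 ≤ 𝔼 p, mismatch p.1 t (q (sketch u p)) (q (sketch v p)) := by
  constructor
  · have hclose : 𝔼 i, ‖u i - v (i + s)‖ ^ 2 ≤ 1 / 16 :=
      Finset.expect_le Finset.univ_nonempty fun i _ => hs i
    linarith [expect_mismatch_quantized_le hu hv (by norm_num) hq s]
  · intro t hts
    have hfar : 15 / 16 ≤ 𝔼 i, ‖u i - v (i + t)‖ ^ 2 := by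
      refine Finset.le_expect Finset.univ_nonempty fun i _ => ?_
      have hdist : ‖v (i + s) - v (i + t)‖ ^ 2 = 2 := by
        rw [norm_sub_sq (𝕜 := ℂ), hv.1, hv.1, hv.2 (by simpa using hts.symm)]
        norm_num
      have htriangle := norm_sub_sq_le_two (v (i + s)) (u i) (v (i + t))
      rw [norm_sub_rev (v (i + s)) (u i)] at htriangle
      linarith [hs i]
    linarith [expect_norm_sub_sq_le_mismatch_quantized hu hv (by norm_num) hq t]

lemma half_le_measureReal_decodeShift_eq (hk : 2 ≤ k) {q : ℂ → ℂ}
    (hq : ∀ x, ‖x - q x‖ ^ 2 ≤ 1 / 256 * (1 + ‖x‖ ^ 4)) {B : ℝ} (hB : 0 < B)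
    (hqB : ∀ x, 4 * ‖q x‖ ^ 2 ≤ B) {L : ℕ} (hL : 256 * B ^ 2 * Real.log k ≤ L)
    {u v : ZMod k → EuclideanSpace ℂ (Fin d)} (hu : Orthonormal ℂ u) (hv : Orthonormal ℂ v)
    {s : ZMod k} (hs : ∀ i, ‖u i - v (i + s)‖ ^ 2 ≤ 1 / 16) :
    1 / 2 ≤ (Measure.pi fun _ : Fin L =>
      (PMF.uniformOfFintype (ZMod k × (Fin d → ℤˣ))).toMeasure).real
        {ω | decodeShift (fun l => (ω l).1) (fun l => q (sketch u (ω l)))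
          (fun l => q (sketch v (ω l))) = s} := by
  have hk0 : (0 : ℝ) < k := by positivity
  obtain ⟨hclose, hfar⟩ := expect_mismatch_quantized_separated hq hu hv hs
  simp only [← integral_uniformOfFintype] at hclose hfar
  have hprob := one_sub_le_measureReal_pi_forall_sum_lt_iff (a := 0) (b := B)
    (Z := fun t (p : ZMod k × (Fin d → ℤˣ)) => mismatch p.1 t (q (sketch u p)) (q (sketch v p)))
    (fun t => Measurable.of_discrete.aemeasurable)
    (fun t => .of_forall fun p => mismatch_mem_Icc (hqB _) (hqB _) p.1 t)
    (by norm_num) hclose hfar L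
  have herror : (k : ℝ) * Real.exp (-(2 * L * (1 / 16) ^ 2 / (B - 0) ^ 2)) ≤ 1 / 2 := by
    have hexponent : 2 * Real.log k ≤ 2 * L * (1 / 16) ^ 2 / (B - 0) ^ 2 := by
      rw [sub_zero, le_div_iff₀ (by positivity)]
      linarith
    calc (k : ℝ) * Real.exp (-(2 * L * (1 / 16) ^ 2 / (B - 0) ^ 2))
        ≤ k * Real.exp (-(2 * Real.log k)) := by gcongr
      _ = 1 / k := by
          rw [two_mul, neg_add, Real.exp_add, Real.exp_neg, Real.exp_log hk0]
          field_simp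
      _ ≤ 1 / 2 := by
          gcongr
          exact_mod_cast hk
  rw [ZMod.card] at hprob
  calc (1 / 2 : ℝ) ≤ 1 - k * Real.exp (-(2 * L * (1 / 16) ^ 2 / (B - 0) ^ 2)) := by linarith
    _ ≤ _ := hprob
    _ ≤ _ := measureReal_mono fun ω hω => decodeShift_eq hω

/-- The functions of a pair of vertices that decode a shift from a labelling of the vertices by `L`
quantized sketches, for some frequencies. -/
noncomputable def shiftPredictors (k : ℕ) [NeZero k] (V : Type*) [Fintype V] [DecidableEq V]
    (Q : Finset ℂ) (L : ℕ) : Finset (V → V → ZMod k) :=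
  Finset.univ.image fun (p : (Fin L → ZMod k) × (V → Fin L → Q)) v w =>
    decodeShift p.1 (fun l => p.2 v l) (fun l => p.2 w l)

lemma card_shiftPredictors_le (V : Type*) [Fintype V] [DecidableEq V] (Q : Finset ℂ) (L : ℕ) :
    (shiftPredictors k V Q L).card ≤ k ^ L * (Q.card ^ L) ^ Fintype.card V := by
  refine Finset.card_image_le.trans_eq ?_
  simp [ZMod.card]

lemma exists_shiftPredictors_mul_card_le (hk : 2 ≤ k) {Q : Finset ℂ} {q : ℂ → Q}
    (hq : ∀ x, ‖x - q x‖ ^ 2 ≤ 1 / 256 * (1 + ‖x‖ ^ 4)) {B : ℝ} (hB : 0 < B)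
    (hQB : ∀ y ∈ Q, 4 * ‖y‖ ^ 2 ≤ B) {L : ℕ} (hL : 256 * B ^ 2 * Real.log k ≤ L)
    {V : Type*} [Fintype V] [DecidableEq V] {u : V → ZMod k → EuclideanSpace ℂ (Fin d)}
    (hu : ∀ v, Orthonormal ℂ (u v)) {ι : Type*} (F : Finset ι) (a b : ι → V) (s : ι → ZMod k)
    (hs : ∀ e ∈ F, ∀ i, ‖u (a e) i - u (b e) (i + s e)‖ ^ 2 ≤ 1 / 16) :
    ∃ T ∈ shiftPredictors k V Q L,
      1 / 2 * (F.card : ℝ) ≤ (F.filter fun e => T (a e) (b e) = s e).card := by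
  obtain ⟨ω, hω⟩ := exists_mul_card_le_card_filter
    (μ := Measure.pi fun _ : Fin L => (PMF.uniformOfFintype (ZMod k × (Fin d → ℤˣ))).toMeasure) F
    (fun _ _ => MeasurableSet.of_discrete) fun e he =>
      half_le_measureReal_decodeShift_eq hk hq hB (fun x => hQB _ (q x).2) hL (hu (a e)) (hu (b e))
        (hs e he)
  exact ⟨_, Finset.mem_image.2
    ⟨(fun l => (ω l).1, fun v l => q (sketch (u v) (ω l))), Finset.mem_univ _, rfl⟩, hω⟩

end Decoding

section Predictors

lemma pow_mul_pow_pow_le_exp {k m L n : ℕ} (hk : 2 ≤ k) (hm : 1 ≤ m) {K : ℝ} (hK : 0 ≤ K)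
    (hL : (L : ℝ) ≤ K * Real.log k) :
    (k ^ L * (m ^ L) ^ n : ℝ) ≤
      Real.exp (K * (1 + Real.log m) * (n + Real.log k) * Real.log k) := by
  have : 0 ≤ Real.log k := Real.log_natCast_nonneg k
  have : 0 ≤ Real.log m := Real.log_natCast_nonneg m
  have hexp {x : ℕ} (hx : 1 ≤ x) (j : ℕ) : (x ^ j : ℝ) = Real.exp (j * Real.log x) := by
    rw [Real.exp_nat_mul, Real.exp_log (by positivity)]
  rw [← pow_mul, hexp (by lia), hexp hm, ← Real.exp_add, Real.exp_le_exp]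
  calc (L * Real.log k + (L * n : ℕ) * Real.log m : ℝ)
      = L * (Real.log k + n * Real.log m) := by push_cast; ring
    _ ≤ K * Real.log k * ((1 + Real.log m) * (n + Real.log k)) := by
        gcongr
        have : 0 ≤ n + Real.log m * Real.log k := by positivity
        linarith
    _ = K * (1 + Real.log m) * (n + Real.log k) * Real.log k := by ring

lemma exists_finset_shift_predictors :
    ∃ K : ℝ, 0 < K ∧ ∀ (k : ℕ) [NeZero k], 2 ≤ k → ∀ (V : Type*) [Fintype V],
      ∃ 𝒯 : Finset (V → V → ZMod k),
        (𝒯.card : ℝ) ≤ Real.exp (K * (Fintype.card V + Real.log k) * Real.log k) ∧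
        ∀ (d : ℕ) (u : V → ZMod k → EuclideanSpace ℂ (Fin d)), (∀ v, Orthonormal ℂ (u v)) →
        ∀ {ι : Type*} (F : Finset ι) (a b : ι → V) (s : ι → ZMod k),
          (∀ e ∈ F, ∀ i, ‖u (a e) i - u (b e) (i + s e)‖ ^ 2 ≤ 1 / 16) →
          ∃ T ∈ 𝒯, 1 / 2 * (F.card : ℝ) ≤ (F.filter fun e => T (a e) (b e) = s e).card := by
  classical
  obtain ⟨Q, q, hq⟩ := exists_finite_quantizer (E := ℂ) (a := 1 / 256) (by norm_num)
  obtain ⟨R, hR, hQR⟩ := Q.finite_toSet.isBounded.exists_pos_norm_le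
  obtain ⟨B, hB, hQB⟩ : ∃ B : ℝ, 0 < B ∧ ∀ y ∈ Q, 4 * ‖y‖ ^ 2 ≤ B :=
    ⟨4 * R ^ 2, by positivity, fun y hy => by gcongr; exact hQR y hy⟩
  have hQ1 : 1 ≤ Q.card := Finset.card_pos.2 ⟨_, (q 0).2⟩
  refine ⟨(256 * B ^ 2 + 2) * (1 + Real.log Q.card), ?_, fun k _ hk V _ =>
    ⟨shiftPredictors k V Q ⌈256 * B ^ 2 * Real.log k⌉₊, ?_, ?_⟩⟩
  · have := Real.log_natCast_nonneg Q.card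
    positivity
  · have hlog : 1 / 2 ≤ Real.log k := by
      have : Real.log 2 ≤ Real.log k := Real.log_le_log two_pos (by exact_mod_cast hk)
      linarith [Real.log_two_gt_d9]
    have hceil := Nat.ceil_lt_add_one (a := 256 * B ^ 2 * Real.log k) (by positivity)
    refine le_trans ?_ (pow_mul_pow_pow_le_exp hk hQ1 (by positivity)
      (L := ⌈256 * B ^ 2 * Real.log k⌉₊) (by linarith))
    exact_mod_cast card_shiftPredictors_le V Q _
  · intro d u hu ι F a b s hs
    exact exists_shiftPredictors_mul_card_le hk hq hB hQB (Nat.le_ceil _) hu F a b s hs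

end Predictors

section RandomShifts

variable {ι κ : Type*} [Fintype ι] [DecidableEq ι] [Fintype κ]

lemma expect_pi_prod (f : ι → κ → ℝ) : 𝔼 r : ι → κ, ∏ i, f i (r i) = ∏ i, 𝔼 y, f i y := by
  simp only [Fintype.expect_eq_sum_div_card]
  rw [Finset.prod_div_distrib, Finset.prod_univ_sum, Fintype.piFinset_univ, Finset.prod_const]
  simp

variable [DecidableEq κ] [Nonempty κ]

lemma expect_pow_card_agree (T : ι → κ) (A : ℝ) :
    𝔼 r : ι → κ, A ^ (Finset.univ.filter fun i => T i = r i).card =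
      (1 + (A - 1) / Fintype.card κ) ^ Fintype.card ι := by
  have hfactor (i : ι) : 𝔼 y, (if T i = y then A else 1) = 1 + (A - 1) / Fintype.card κ := by
    calc 𝔼 y, (if T i = y then A else 1) = 𝔼 y, (1 + if T i = y then A - 1 else 0) := by
          refine Finset.expect_congr rfl fun y _ => ?_
          split_ifs <;> ring
      _ = 1 + (A - 1) / Fintype.card κ := by
          rw [Finset.expect_add_distrib, Fintype.expect_const, Fintype.expect_eq_sum_div_card]
          simp
  calc 𝔼 r : ι → κ, A ^ (Finset.univ.filter fun i => T i = r i).card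
      = 𝔼 r : ι → κ, ∏ i, if T i = r i then A else 1 := by
        refine Finset.expect_congr rfl fun r _ => ?_
        rw [Finset.prod_ite, Finset.prod_const, Finset.prod_const_one, mul_one]
    _ = ∏ i, 𝔼 y, if T i = y then A else 1 := expect_pi_prod fun i y => if T i = y then A else 1
    _ = (1 + (A - 1) / Fintype.card κ) ^ Fintype.card ι := by
        simp only [hfactor, Finset.prod_const, Finset.card_univ]

variable [MeasurableSpace κ] [MeasurableSingletonClass κ]

lemma measureReal_le_card_agree_le (T : ι → κ) {A : ℝ} (hA : 1 ≤ A) (x : ℝ) :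
    (PMF.uniformOfFintype (ι → κ)).toMeasure.real
        {r | x ≤ (Finset.univ.filter fun i => T i = r i).card} ≤
      Real.exp (Fintype.card ι * ((A - 1) / Fintype.card κ)) * A ^ (-x) := by
  have hA0 : 0 < A := by linarith
  set μ := (PMF.uniformOfFintype (ι → κ)).toMeasure
  set agree : (ι → κ) → ℕ := fun r => (Finset.univ.filter fun i => T i = r i).card
  have hmarkov : A ^ x * μ.real {r | A ^ x ≤ A ^ agree r} ≤
      Real.exp (Fintype.card ι * ((A - 1) / Fintype.card κ)) := by
    calc A ^ x * μ.real {r | A ^ x ≤ A ^ agree r}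
        ≤ ∫ r, A ^ agree r ∂μ := mul_meas_ge_le_integral_of_nonneg
          (.of_forall fun r => by positivity) .of_finite _
      _ = (1 + (A - 1) / Fintype.card κ) ^ Fintype.card ι := by
          rw [integral_uniformOfFintype, expect_pow_card_agree]
      _ ≤ Real.exp ((A - 1) / Fintype.card κ) ^ Fintype.card ι := by
          gcongr
          linarith [Real.add_one_le_exp ((A - 1) / Fintype.card κ)]
      _ = Real.exp (Fintype.card ι * ((A - 1) / Fintype.card κ)) := (Real.exp_nat_mul _ _).symm
  have hsub : {r | x ≤ agree r} ⊆ {r | A ^ x ≤ A ^ agree r} := fun r hr => by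
    simpa using Real.rpow_le_rpow_of_exponent_le hA hr
  rw [Real.rpow_neg hA0.le, ← div_eq_mul_inv, le_div_iff₀' (by positivity)]
  exact (mul_le_mul_of_nonneg_left (measureReal_mono hsub) (by positivity)).trans hmarkov

lemma measureReal_exists_le_card_agree_le (𝒯 : Finset (ι → κ)) {A : ℝ} (hA : 1 ≤ A) (x : ℝ) :
    (PMF.uniformOfFintype (ι → κ)).toMeasure.real
        {r | ∃ T ∈ 𝒯, x ≤ (Finset.univ.filter fun i => T i = r i).card} ≤
      𝒯.card * (Real.exp (Fintype.card ι * ((A - 1) / Fintype.card κ)) * A ^ (-x)) := by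
  have hunion : {r : ι → κ | ∃ T ∈ 𝒯, x ≤ (Finset.univ.filter fun i => T i = r i).card} =
      ⋃ T ∈ 𝒯, {r | x ≤ (Finset.univ.filter fun i => T i = r i).card} := by
    ext r
    simp
  rw [hunion, ← nsmul_eq_mul]
  exact (measureReal_biUnion_finset_le _ _).trans
    (Finset.sum_le_card_nsmul _ _ _ fun T _ => measureReal_le_card_agree_le T hA x)

lemma exp_mul_exp_mul_sqrt_rpow_le {k n N : ℕ} {K M : ℝ} (hK : 0 ≤ K) (hk : 64 ≤ k)
    (hn : Real.log k ≤ n) (hM : (16 * K + 8) * n ≤ M) (hN : N ≤ M * Real.log k) :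
    Real.exp (K * (n + Real.log k) * Real.log k) *
      (Real.exp (N * ((√k - 1) / k)) * √k ^ (-(M / 2))) ≤ Real.exp (-n) := by
  have hk' : (64 : ℝ) ≤ k := by exact_mod_cast hk
  have hlog : 1 ≤ Real.log k := by
    rw [Real.le_log_iff_exp_le (by linarith)]
    linarith [Real.exp_one_lt_d9]
  have hsqrt : 8 ≤ √(k : ℝ) := Real.le_sqrt_of_sq_le (by linarith)
  have : 0 ≤ M := le_trans (by positivity) hM
  have hpow : √(k : ℝ) ^ (-(M / 2)) = Real.exp (-(M * Real.log k / 4)) := by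
    rw [Real.rpow_def_of_pos (by positivity), Real.log_sqrt (by positivity)]
    ring_nf
  have hfew : N * ((√k - 1) / k) ≤ M * Real.log k / 8 := by
    have : (√k - 1) / (k : ℝ) ≤ 1 / 8 := by
      rw [div_le_div_iff₀ (by linarith) (by norm_num)]
      nlinarith [Real.sq_sqrt (show (0 : ℝ) ≤ k by positivity)]
    calc N * ((√k - 1) / k) ≤ N * (1 / 8) := by gcongr
      _ ≤ M * Real.log k / 8 := by linarith
  have hcodebook : K * (n + Real.log k) * Real.log k ≤ K * (n + n) * Real.log k := by gcongr
  have hgain : (16 * K + 8) * n * Real.log k ≤ M * Real.log k := by gcongr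
  have hloss : (n : ℝ) ≤ n * Real.log k := le_mul_of_one_le_right n.cast_nonneg hlog
  rw [hpow, ← Real.exp_add, ← Real.exp_add, Real.exp_le_exp]
  linarith

end RandomShifts

section LinearGame

variable {V : Type*} {G : SimpleGraph V} {k : ℕ}

lemma LinearGame.corrupt_coe (s : LinearGame G k) {Eε : Finset G.edgeSet} (r : Eε → ZMod k)
    (e : Eε) : s.corrupt Eε r e = r e := by
  simp [LinearGame.corrupt]

open Classical in
lemma LinearGame.toReal_toOuterMeasure_randomlyCorrupted [NeZero k] (s : LinearGame G k)
    (Eε : Finset G.edgeSet) (S : Set (LinearGame G k)) :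
    ((s.randomlyCorrupted Eε).toOuterMeasure S).toReal =
      (PMF.uniformOfFintype (Eε → ZMod k)).toMeasure.real (s.corrupt Eε ⁻¹' S) := by
  rw [LinearGame.randomlyCorrupted, PMF.toOuterMeasure_map_apply, measureReal_def,
    PMF.toMeasure_apply_eq_toOuterMeasure]

lemma IsSDPFeasible.orthonormal {F : Type*} [NormedAddCommGroup F] [InnerProductSpace ℝ F]
    {u : V → ZMod k → F} (hu : IsSDPFeasible u) (v : V) : Orthonormal ℝ (u v) :=
  ⟨hu.norm_eq_one v, fun i j => hu.orthogonal v i j⟩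

open Classical in
lemma LinearGame.ncard_isShort_eq_card_filter (s : LinearGame G k) (Eε : Finset G.edgeSet)
    {F : Type*} [NormedAddCommGroup F] [InnerProductSpace ℝ F] (u : V → ZMod k → F) (η : ℝ) :
    {e : G.edgeSet | e ∈ Eε ∧ s.IsShort u η e}.ncard =
      (Finset.univ.filter fun e : Eε => s.IsShort u η e).card := by
  rw [← Finset.card_map (Function.Embedding.subtype _), ← Set.ncard_coe_finset]
  congr 1
  ext e
  simpa using and_comm

lemma mul_le_card_of_mul_card_mul_le_card_edgeSet [Fintype V] [Nonempty V] [Fintype G.edgeSet]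
    {C x : ℝ} (h : C * (Fintype.card V : ℝ) * x ≤ Fintype.card G.edgeSet) :
    C * x ≤ Fintype.card V := by
  classical
  have hedges : Fintype.card G.edgeSet ≤ Fintype.card V * Fintype.card V := by
    rw [← SimpleGraph.edgeFinset_card, ← sq]
    exact G.card_edgeFinset_le_card_choose_two.trans (Nat.choose_le_pow _ _)
  have hedges' : (Fintype.card G.edgeSet : ℝ) ≤ Fintype.card V * Fintype.card V := by
    exact_mod_cast hedges
  have hV : (0 : ℝ) < Fintype.card V := Nat.cast_pos.2 Fintype.card_pos
  exact le_of_mul_le_mul_right (by linarith) hV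

open Classical in
lemma measureReal_many_isShort_le [NeZero k] (s : LinearGame G k) (Eε : Finset G.edgeSet)
    (𝒯 : Finset (V → V → ZMod k))
    (h𝒯 : ∀ (d : ℕ) (u : V → ZMod k → EuclideanSpace ℂ (Fin d)), (∀ v, Orthonormal ℂ (u v)) →
      ∀ (F : Finset Eε) (a b : Eε → V) (r : Eε → ZMod k),
        (∀ e ∈ F, ∀ i, ‖u (a e) i - u (b e) (i + r e)‖ ^ 2 ≤ 1 / 16) →
        ∃ T ∈ 𝒯, 1 / 2 * (F.card : ℝ) ≤ (F.filter fun e => T (a e) (b e) = r e).card)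
    {A : ℝ} (hA : 1 ≤ A) (M : ℝ) :
    (PMF.uniformOfFintype (Eε → ZMod k)).toMeasure.real
        {r | ∃ (d : ℕ) (u : V → ZMod k → EuclideanSpace ℝ (Fin d)), (∀ v, Orthonormal ℝ (u v)) ∧
          M < {e : G.edgeSet | e ∈ Eε ∧ (s.corrupt Eε r).IsShort u (1 / 32) e}.ncard} ≤
      𝒯.card * (Real.exp (Eε.card * ((A - 1) / k)) * A ^ (-(M / 2))) := by
  set 𝒯' : Finset (Eε → ZMod k) := 𝒯.image fun T e => T (edgeTail e.1) (edgeHead e.1)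
  have hprob := measureReal_exists_le_card_agree_le 𝒯' hA (M / 2)
  rw [Fintype.card_coe, ZMod.card] at hprob
  have hcard : 𝒯'.card ≤ 𝒯.card := Finset.card_image_le
  refine (measureReal_mono fun r => ?_).trans (hprob.trans (by gcongr))
  rintro ⟨d, u, hu, hM⟩
  rw [LinearGame.ncard_isShort_eq_card_filter] at hM
  obtain ⟨T, hT, hagree⟩ := h𝒯 d (fun v i => complexify (u v i))
    (fun v => orthonormal_complexify (hu v))
    (Finset.univ.filter fun e : Eε => (s.corrupt Eε r).IsShort u (1 / 32) e)
    (fun e => edgeTail e.1) (fun e => edgeHead e.1) r fun e he i => by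
      have hshort := (Finset.mem_filter.1 he).2 i
      rw [LinearGame.corrupt_coe] at hshort
      rw [norm_complexify_sub]
      linarith
  refine ⟨_, Finset.mem_image_of_mem _ hT, ?_⟩
  calc M / 2 ≤ 1 / 2 * _ := by linarith
    _ ≤ _ := hagree
    _ ≤ _ := by gcongr; exact Finset.filter_subset _ _

end LinearGame

theorem mainTheorem5_general :
    ∃ C : ℝ, 0 < C ∧ ∀ (k : ℕ) [NeZero k], 64 ≤ k → ∀ γ : ℝ, 0 < γ → γ ≤ 1 / Real.log k →
      ∀ (V : Type*) [Fintype V] (G : SimpleGraph V) [Fintype G.edgeSet],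
        C * (Fintype.card V : ℝ) * γ⁻¹ ≤ (Fintype.card G.edgeSet : ℝ) →
      ∀ (s : LinearGame G k) (Eε : Finset G.edgeSet),
        (Eε.card : ℝ) ≤ γ * Real.log k * (Fintype.card G.edgeSet : ℝ) →
        1 - Real.exp (-(Fintype.card V : ℝ)) ≤
          ((s.randomlyCorrupted Eε).toOuterMeasure
            {s' : LinearGame G k |
              ∀ (d : ℕ) (u : V → ZMod k → EuclideanSpace ℝ (Fin d)), (∀ v, Orthonormal ℝ (u v)) →
                (Set.ncard {e : G.edgeSet | e ∈ Eε ∧ s'.IsShort u (1 / 32) e} : ℝ) ≤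
                  γ * (Fintype.card G.edgeSet : ℝ)}).toReal := by
  classical
  obtain ⟨K, hK, hpredictors⟩ := exists_finset_shift_predictors
  refine ⟨16 * K + 8, by positivity, fun k _ hk γ hγ hγk V _ G _ hE s Eε hEε => ?_⟩
  rcases isEmpty_or_nonempty V with hV | hV
  · simp
  obtain ⟨𝒯, hcard, h𝒯⟩ := hpredictors k (by lia) V
  have hlog : 0 < Real.log k := Real.log_pos (by exact_mod_cast (by lia : 1 < k))
  have hn : Real.log k ≤ Fintype.card V := by
    have hγ' : Real.log k ≤ γ⁻¹ := (le_inv_comm₀ hlog hγ).2 (by simpa using hγk)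
    have hcardV := mul_le_card_of_mul_card_mul_le_card_edgeSet hE
    have : 0 ≤ K * γ⁻¹ := by positivity
    linarith
  have hM : (16 * K + 8) * Fintype.card V ≤ γ * Fintype.card G.edgeSet := by
    rwa [← div_eq_mul_inv, div_le_iff₀' hγ] at hE
  have hbad := (measureReal_many_isShort_le s Eε 𝒯 (fun d u hu => h𝒯 d u hu)
    (Real.one_le_sqrt.2 (by exact_mod_cast (by lia : 1 ≤ k))) _).trans
    ((mul_le_mul_of_nonneg_right hcard (by positivity)).trans
      (exp_mul_exp_mul_sqrt_rpow_le hK.le hk hn hM (by linarith)))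
  rw [LinearGame.toReal_toOuterMeasure_randomlyCorrupted]
  have hgood := probReal_compl_eq_one_sub (μ := (PMF.uniformOfFintype (Eε → ZMod k)).toMeasure)
    (.of_discrete (s := {r | ∃ (d : ℕ) (u : V → ZMod k → EuclideanSpace ℝ (Fin d)),
      (∀ v, Orthonormal ℝ (u v)) ∧ γ * Fintype.card G.edgeSet <
        {e : G.edgeSet | e ∈ Eε ∧ (s.corrupt Eε r).IsShort u (1 / 32) e}.ncard}))
  refine (le_trans (by linarith) hgood.ge).trans (measureReal_mono fun r hr d u hu => ?_)
  exact not_lt.1 fun hlt => hr ⟨d, u, hu, hlt⟩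

theorem mainTheorem5 :
    ∃ (k₀ : ℕ) (C : ℝ) (δ : ℕ → ℝ), 0 < C ∧ Filter.Tendsto δ Filter.atTop (nhds 0) ∧
      ∀ (k : ℕ) [NeZero k], k₀ ≤ k →
      ∀ ε : ℝ, 0 < ε → ε < 1 →
      ∀ γ : ℝ, ε / Real.log k < γ → γ < 1 / Real.log k →
      ∀ (V : Type*) [Fintype V] (G : SimpleGraph V) [Fintype G.edgeSet],
        C * (Fintype.card V : ℝ) * γ⁻¹ ≤ (Fintype.card G.edgeSet : ℝ) →
      ∀ s : LinearGame G k, s.IsSatisfiable →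
      ∀ Eε : Finset G.edgeSet, (Eε.card : ℝ) = ε * (Fintype.card G.edgeSet : ℝ) →
        1 - δ (Fintype.card V) ≤
          ((s.randomlyCorrupted Eε).toOuterMeasure
            {s' : LinearGame G k |
              ∀ (d : ℕ) (u : V → ZMod k → EuclideanSpace ℝ (Fin d)), s'.IsSDPOptimal u →
                (Set.ncard {e : G.edgeSet | e ∈ Eε ∧ s'.IsShort u (1 / 32) e} : ℝ) ≤
                  γ * (Fintype.card G.edgeSet : ℝ)}).toReal := by
  obtain ⟨C, hC, hmain⟩ := mainTheorem5_general
  refine ⟨64, C, fun n => Real.exp (-n), hC,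
    Real.tendsto_exp_neg_atTop_nhds_zero.comp tendsto_natCast_atTop_atTop,
    fun k _ hk ε hε _ γ hεγ hγ V _ G _ hE s _ Eε hEε => ?_⟩
  have hlog : 0 < Real.log k := Real.log_pos (by exact_mod_cast (by lia : 1 < k))
  have hεγ' : ε ≤ γ * Real.log k := ((div_lt_iff₀ hlog).1 hεγ).le
  refine (hmain k hk γ ((div_pos hε hlog).trans hεγ) hγ.le V G hE s Eε
    (hEε.trans_le (by gcongr))).trans (ENNReal.toReal_mono ?_ ?_)
  · exact PMF.toOuterMeasure_apply _ _ ▸ PMF.tsum_coe_indicator_ne_top _ _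
  · exact MeasureTheory.measure_mono fun s' hs' d u hu => hs' d u hu.1.orthonormal
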